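/- Let $n\ge 2$. Write $\mathbb{TP}^{n-1}=\mathbb R^n/\mathbb R(1,\dots,1)$, with the quotient topology. Let $v^1,\dots,v^p\in\mathbb{TP}^{n-1}$ with $p\ge n$ be in general position: for every square submatrix $U=(u_{ij})\in\mathbb{R}^{k\times k}$ of the $n\times p$ matrix with columns $v^1,\dots,v^p$, the maximum $\max_{\sigma}(u_{1\sigma(1)}+\dots+u_{k\sigma(k)})$ over permutations $\sigma$ of $\{1,\dots,k\}$ is attained only once. Let $$P=\Bigl\{\bigl(\max_{r}(\lambda_r+v^r_i)\bigr)_{1\le i\le n}\in\mathbb{TP}^{n-1} : \lambda_1,\dots,\lambda_p\in\mathbb R\Bigr\}$$ be the tropical polytope which they generate. For $a\in\mathbb{TP}^{n-1}$ and $\emptyset\ne I\subsetneq\{1,\dots,n\}$ let $$H(a,I)=\Bigl\{x\in\mathbb{TP}^{n-1} : \max_{i\in I}(x_i-a_i)\ \ge\ \max_{j\notin I}(x_j-a_j)\Bigr\}.$$ Let $\mathbb K$ be the ordered field of real Hahn series $\mathbf x=\sum_{\alpha\in\mathbb R}x_\alpha t^\alpha$ with well-ordered support, where $\mathbf x>0$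 if and only if the coefficient of the least exponent $\alpha_{\min}(\mathbf{x})$ of $\mathbf x\neq 0$ is positive, and let $\mathrm{val}(\mathbf x)=-\alpha_{\min}(\mathbf x)$ for $\mathbf{x}\neq 0$, extended to vectors component-wise. Let $\mathbb K^+$ be the set of positive elements of $\mathbb{K}$. Let $\mathbf v^1,\dots,\mathbf v^p\in(\mathbb K^+)^n$ satisfy $\mathrm{val}(\mathbf v^r)=v^r$ in $\mathbb{TP}^{n-1}$ for all $r$, so that $\mathcal P=\mathrm{cone}\{\mathbf v^1,\dots,\mathbf v^p\}\subset\mathbb K^n$ is a lift of $P$, and let $R\subset\{1,\dots,p\}$ have $n-1$ elements. Then $\mathrm{cone}\{\mathbf v^r : r\in R\}$ is a facet of $\mathcal P$ (a face of dimension $\dim\mathcal P-1$) if and only if there exists a tropical half-space $H(a,I)$ such that $P\subset H(a,I)$ and all $v^r$, $r\in R$, lie on the (topological) boundary of $H(a,I)$. Moreover, whenever $H(a,I)$ is such a tropical half-space, there is a unique half-space $\mathcal H=\{\mathbf x\in\mathbb K^n:\sum_i\mathbf f_i\mathbf x_i\ge0\}$, $\mathbf f\ne0$, which defines the facet, that is,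 with $\mathcal P\subset\mathcal H$ and $\mathrm{cone}\{\mathbf v^r : r\in R\}=\mathcal P\cap\{\mathbf x:\sum_i\mathbf f_i\mathbf x_i=0\}$, and $\mathrm{val}(\mathcal H\cap(\mathbb K^+)^n)=H(a,I)$. -/

import Mathlib

noncomputable section

namespace TropicalLift

/-! ### Tropical projective space, tropical polytopes and half-spaces -/

/-- The tropical projective space `ℝⁿ / ℝ(1,…,1)`, with its quotient topology. -/
abbrev TP (n : ℕ) : Type :=
  (Fin n → ℝ) ⧸ Submodule.span ℝ {(fun _ => 1 : Fin n → ℝ)}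

/-- The point of `TP n` with homogeneous coordinates `x`. -/
def toTP {n : ℕ} (x : Fin n → ℝ) : TP n :=
  Submodule.Quotient.mk x

/-- The tropical permanent `max_σ (u_{1σ(1)} + ⋯ + u_{kσ(k)})`. -/
def tper {k : ℕ} (U : Matrix (Fin k) (Fin k) ℝ) : ℝ :=
  (Finset.univ : Finset (Equiv.Perm (Fin k))).sup' Finset.univ_nonempty
    fun σ => ∑ i, U i (σ i)

/-- The maximum in the tropical permanent is attained at least twice. -/
def TropicallySingular {k : ℕ} (U : Matrix (Fin k) (Fin k) ℝ) : Prop :=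
  ∃ σ τ : Equiv.Perm (Fin k), σ ≠ τ ∧
    ∑ i, U i (σ i) = tper U ∧ ∑ i, U i (τ i) = tper U

/-- The points with homogeneous coordinates `v 1, …, v p` are in general position: every square
submatrix of the `n × p` matrix with columns `v r` is tropically non-singular. (This does not
depend on the choice of the homogeneous coordinates.) -/
def GeneralPosition {n p : ℕ} (v : Fin p → Fin n → ℝ) : Prop :=
  ∀ (k : ℕ) (row : Fin k ↪o Fin n) (col : Fin k ↪o Fin p),
    ¬ TropicallySingular (Matrix.of fun i j => v (col j) (row i))

/-- The tropical polytope generated by the points with homogeneous coordinates `v 1, …, v p`: the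
set of all `(l 1 ⊙ v 1) ⊕ ⋯ ⊕ (l p ⊙ v p)` with `l r ∈ ℝ`. The maxima are computed in
`WithBot ℝ = ℝ ∪ {-∞}`. -/
def tropicalPolytope {n p : ℕ} (v : Fin p → Fin n → ℝ) : Set (TP n) :=
  toTP '' {x | ∃ l : Fin p → ℝ, ∀ i,
    (x i : WithBot ℝ) = Finset.univ.sup fun r => ((l r + v r i : ℝ) : WithBot ℝ)}

/-- The tropical half-space `max_{i ∈ I} (x i - a i) ≥ max_{j ∉ I} (x j - a j)` whose apex has
homogeneous coordinates `a`. -/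
def tropicalHalfSpace {n : ℕ} (a : Fin n → ℝ) (I : Finset (Fin n)) : Set (TP n) :=
  toTP '' {x | (Iᶜ.sup fun j => ((x j - a j : ℝ) : WithBot ℝ)) ≤
    I.sup fun i => ((x i - a i : ℝ) : WithBot ℝ)}

/-! ### The ordered field of real Hahn series and lifts -/

/-- Real Hahn series with value group `(ℝ, +, ≤)`, ordered by the sign of the leading
coefficient. (This is Mathlib's ordered field `Lex (HahnSeries ℝ ℝ)`.) -/
def HahnField : Type := Lex (HahnSeries ℝ ℝ)

instance : Field HahnField := inferInstanceAs (Field (Lex (HahnSeries ℝ ℝ)))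

instance : LinearOrder HahnField := inferInstanceAs (LinearOrder (Lex (HahnSeries ℝ ℝ)))

instance : IsStrictOrderedRing HahnField :=
  inferInstanceAs (IsStrictOrderedRing (Lex (HahnSeries ℝ ℝ)))

/-- The underlying Hahn series. -/
def HahnField.toSeries (x : HahnField) : HahnSeries ℝ ℝ := ofLex (show Lex (HahnSeries ℝ ℝ) from x)

/-- The valuation of a non-zero Hahn series: minus the least element of its support.
(It is only ever applied to positive series.) -/
def val (x : HahnField) : ℝ := -x.toSeries.order

/-- The point of `TP n` given by the valuations of the coordinates of a vector. -/
def valTP {n : ℕ} (x : Fin n → HahnField) : TP n := toTP fun i => val (x i)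

/-- `w 1, …, w p` are vectors with positive coordinates whose images under the valuation map are
the points `v 1, …, v p`, that is, `cone {w r}` is a lift of the tropical polytope generated by
the `v r`. -/
def IsLift {n p : ℕ} (w : Fin p → Fin n → HahnField) (v : Fin p → Fin n → ℝ) : Prop :=
  (∀ r i, 0 < w r i) ∧ ∀ r, valTP (w r) = toTP (v r)

/-- The image under the valuation map of (the positive points of) a subset of `𝕂ⁿ`. -/
def valImage {n : ℕ} (H : Set (Fin n → HahnField)) : Set (TP n) :=
  valTP '' (H ∩ {x | ∀ i, 0 < x i})

/-- `F` is a facet of the cone `C`: a face whose dimension is one less than that of `C`. -/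
def IsFacet {n : ℕ} (F C : PointedCone HahnField (Fin n → HahnField)) : Prop :=
  F.IsFaceOf C ∧
    Module.finrank HahnField (Submodule.span HahnField (F : Set (Fin n → HahnField))) + 1 =
      Module.finrank HahnField (Submodule.span HahnField (C : Set (Fin n → HahnField)))

/-- `H` is a half-space `{x | ∑ f i * x i ≥ 0}` which defines the face `F` of the cone `C`: it
contains `C`, and `F` is the intersection of `C` with its bounding hyperplane. -/
def IsDefiningHalfSpace {n : ℕ} (H : Set (Fin n → HahnField))
    (F C : PointedCone HahnField (Fin n → HahnField)) : Prop :=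
  ∃ f : Fin n → HahnField, f ≠ 0 ∧ H = {x | 0 ≤ ∑ i, f i * x i} ∧
    (C : Set (Fin n → HahnField)) ⊆ H ∧
    (F : Set (Fin n → HahnField)) = (C : Set (Fin n → HahnField)) ∩ {x | ∑ i, f i * x i = 0}

end TropicalLift

end

open TropicalLift

namespace TropicalLift

/-! ### The valuation on the Hahn field -/

/-! The hyperplane through `n - 1` lifted generators has the signed maximal minors as its normal
vector, and its value at another generator is an `n × n` determinant. In general position exactly
one permutation product in each of these determinants has the largest valuation. Nothing can cancel
it, so it fixes the sign and the valuation of the determinant. Hence the signs and valuations of the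
normal coordinates, and the side on which each other generator lies, are the same for all lifts
(`GeneralPosition.normal_of_lift`).

A form `f` without zero coordinates corresponds to `H(a, I)` with `I` the set of positive
coordinates and `a = -val f`. A facet gives a tropical half-space by applying `val` to its
supporting form. Conversely, for a given `H(a, I)` pick any form with these signs and valuations,
and lift the points anew so that they suit this form: all in its half-space, those of `R` on its
hyperplane. The form is then a multiple of the normal of the new lift, and invariance carries its
signs, valuations and positivity back to the original lift
(`GeneralPosition.exists_lift_halfSpace`).

The valuation is handled through Archimedean domination: `val x ≤ val y` means that an integer
multiple of `|y|` bounds `|x|`. -/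

theorem val_le_val_iff {x y : HahnField} (hx : x ≠ 0) (hy : y ≠ 0) :
    val x ≤ val y ↔ ∃ k : ℕ, |x| ≤ k * |y| := by
  have hx' : HahnField.toSeries x ≠ 0 := hx
  have hy' : HahnField.toSeries y ≠ 0 := hy
  have h1 : val x ≤ val y ↔ (HahnField.toSeries y).orderTop ≤ (HahnField.toSeries x).orderTop := by
    rw [← HahnSeries.order_eq_orderTop_of_ne_zero hx', ← HahnSeries.order_eq_orderTop_of_ne_zero hy',
      WithTop.coe_le_coe, val, val, neg_le_neg_iff]
  have h2 := (HahnSeries.archimedeanClassOrderIsoWithTop ℝ ℝ).le_iff_le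
    (x := ArchimedeanClass.mk (show Lex (HahnSeries ℝ ℝ) from y))
    (y := ArchimedeanClass.mk (show Lex (HahnSeries ℝ ℝ) from x))
  rw [HahnSeries.archimedeanClassOrderIsoWithTop_apply,
    HahnSeries.archimedeanClassOrderIsoWithTop_apply, ArchimedeanClass.mk_le_mk] at h2
  rw [h1]
  refine h2.trans ?_
  simp_rw [nsmul_eq_mul]
  rfl

theorem val_lt_val_iff {x y : HahnField} (hx : x ≠ 0) (hy : y ≠ 0) :
    val x < val y ↔ ∀ k : ℕ, k * |x| < |y| := by
  rw [← not_le, val_le_val_iff hy hx]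
  push Not
  rfl

theorem val_mono {x y : HahnField} (hx : 0 < x) (h : x ≤ y) : val x ≤ val y :=
  (val_le_val_iff hx.ne' (hx.trans_le h).ne').2
    ⟨1, by rwa [abs_of_pos hx, abs_of_pos (hx.trans_le h), Nat.cast_one, one_mul]⟩

theorem val_mul {x y : HahnField} (hx : x ≠ 0) (hy : y ≠ 0) : val (x * y) = val x + val y := by
  have h : (HahnField.toSeries (x * y)).order =
      (HahnField.toSeries x).order + (HahnField.toSeries y).order :=
    HahnSeries.order_mul (x := HahnField.toSeries x) (y := HahnField.toSeries y) hx hy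
  rw [val, val, val, h, neg_add]

theorem val_neg (x : HahnField) : val (-x) = val x := by
  have h : (HahnField.toSeries (-x)).order = (HahnField.toSeries x).order :=
    HahnSeries.order_neg
  rw [val, val, h]

theorem val_abs (x : HahnField) : val |x| = val x := by
  rcases abs_choice x with h | h <;> rw [h]
  exact val_neg x

theorem val_prod {ι : Type*} (s : Finset ι) (x : ι → HahnField) (hx : ∀ i ∈ s, x i ≠ 0) :
    val (∏ i ∈ s, x i) = ∑ i ∈ s, val (x i) := by
  classical
  induction s using Finset.induction_on with
  | empty =>
    have h := val_mul (one_ne_zero (α := HahnField)) one_ne_zero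
    rw [mul_one] at h
    simpa using h
  | insert a s ha ih =>
    rw [Finset.prod_insert ha, Finset.sum_insert ha, val_mul (hx a (by simp)),
      ih fun i hi => hx i (by simp [hi])]
    exact Finset.prod_ne_zero_iff.2 fun i hi => hx i (by simp [hi])

/-- Integer factors are invisible to `val`. A coordinate can therefore be enlarged until it
dominates others of the same valuation, without moving its tropical image. -/
theorem val_natCast_mul {k : ℕ} (hk : k ≠ 0) {x : HahnField} (hx : x ≠ 0) :
    val (k * x) = val x := by
  have hk1 : (1 : HahnField) ≤ k := by exact_mod_cast Nat.one_le_iff_ne_zero.2 hk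
  have hk0 : (0 : HahnField) < k := zero_lt_one.trans_le hk1
  apply le_antisymm
  · rw [val_le_val_iff (mul_ne_zero hk0.ne' hx) hx]
    exact ⟨k, by rw [abs_mul, abs_of_pos hk0]⟩
  · rw [← val_abs x, ← val_abs (k * x), abs_mul, abs_of_pos hk0]
    exact val_mono (abs_pos.2 hx) (le_mul_of_one_le_left (abs_nonneg x) hk1)

theorem exists_pos_val_eq (c : ℝ) : ∃ x : HahnField, 0 < x ∧ val x = c := by
  refine ⟨(toLex (HahnSeries.single (-c) 1) : Lex (HahnSeries ℝ ℝ)), ?_, ?_⟩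
  · refine HahnSeries.leadingCoeff_pos_iff.1 ?_
    simp
  · have h : (HahnSeries.single (-c) (1 : ℝ)).order = -c := HahnSeries.order_single one_ne_zero
    change -(HahnSeries.single (-c) (1 : ℝ)).order = c
    rw [h, neg_neg]

/-- A sum is dominated by a term of strictly largest valuation. -/
theorem sum_dominated {ι : Type*} [DecidableEq ι] (s : Finset ι) (g : ι → HahnField) {i₀ : ι}
    (h₀ : i₀ ∈ s) (hg : ∀ i, g i ≠ 0) (h : ∀ i ∈ s, i ≠ i₀ → val (g i) < val (g i₀)) :
    2 * |∑ i ∈ s, g i - g i₀| < |g i₀| := by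
  have hs : 0 < s.card := Finset.card_pos.2 ⟨i₀, h₀⟩
  -- Strict domination allows the factor `2 * s.card`: each of the `s.card - 1` other terms stays
  -- below `|g i₀|` even after multiplication by it.
  have hle : s.card * (2 * |∑ i ∈ s, g i - g i₀|) ≤ (s.card - 1 : ℕ) * |g i₀| := by
    rw [← Finset.sum_erase_eq_sub h₀, ← Finset.card_erase_of_mem h₀, ← nsmul_eq_mul _ |g i₀|,
      ← mul_assoc]
    refine (mul_le_mul_of_nonneg_left (Finset.abs_sum_le_sum_abs _ _) (by positivity)).trans ?_
    rw [Finset.mul_sum]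
    refine Finset.sum_le_card_nsmul _ _ _ fun i hi => ?_
    have := (val_lt_val_iff (hg i) (hg i₀)).1
      (h i (Finset.mem_of_mem_erase hi) (Finset.ne_of_mem_erase hi)) (s.card * 2)
    exact_mod_cast this.le
  have hlt : ((s.card - 1 : ℕ) : HahnField) * |g i₀| < s.card * |g i₀| := by
    refine mul_lt_mul_of_pos_right ?_ (abs_pos.2 (hg i₀))
    exact_mod_cast Nat.sub_lt hs one_pos
  exact lt_of_mul_lt_mul_left (hle.trans_lt hlt) (by positivity)

/-- The sign and the valuation of an element which is close to `y`. -/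
theorem sign_and_val_of_close {x y : HahnField} (h : 2 * |x - y| < |y|) :
    x ≠ 0 ∧ (0 < x ↔ 0 < y) ∧ val x = val y := by
  -- For positive `y` the hypothesis puts `x` between `y / 2` and `3 * y / 2`, so each of `x`, `y`
  -- is at most twice the other.
  have key : ∀ {x y : HahnField}, 0 < y → 2 * |x - y| < |y| → 0 < x ∧ val x = val y := by
    intro x y hy h
    rw [abs_of_pos hy] at h
    obtain ⟨h1, h2⟩ := abs_le.1 (le_refl |x - y|)
    have hx : 0 < x := by linarith
    refine ⟨hx, le_antisymm ?_ ?_⟩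
    · rw [← val_natCast_mul two_ne_zero hy.ne']
      exact val_mono hx (by push_cast; linarith)
    · rw [← val_natCast_mul two_ne_zero hx.ne']
      exact val_mono hy (by push_cast; linarith)
  rcases lt_trichotomy y 0 with hy | rfl | hy
  · have := key (x := -x) (y := -y) (neg_pos.2 hy) (by
      rwa [abs_neg, neg_sub_neg, abs_sub_comm])
    rw [val_neg, val_neg, neg_pos] at this
    exact ⟨this.1.ne, ⟨fun hx => absurd hx this.1.asymm, fun hx => absurd hx hy.asymm⟩, this.2⟩
  · rw [abs_zero] at h
    exact absurd h (not_lt.2 (by positivity))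
  · have := key hy h
    exact ⟨this.1.ne', ⟨fun _ => hy, fun _ => this.1⟩, this.2⟩

/-! ### Determinants of lifts -/

/-- The sign and the valuation of the determinant of a lift of a tropically non-singular matrix
are determined by the matrix. -/
theorem exists_sign_and_val_det {k : ℕ} {U : Matrix (Fin k) (Fin k) ℝ}
    (hU : ¬ TropicallySingular U) :
    ∃ (c : ℝ) (P : Prop), ∀ A : Matrix (Fin k) (Fin k) HahnField, (∀ i j, 0 < A i j) →
      (∀ i j, val (A i j) = U i j) → A.det ≠ 0 ∧ (0 < A.det ↔ P) ∧ val A.det = c := by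
  obtain ⟨σ, -, hσ⟩ := Finset.exists_mem_eq_sup' (s := (Finset.univ : Finset (Equiv.Perm (Fin k))))
    Finset.univ_nonempty fun σ => ∑ i, U i (σ i)
  have hlt : ∀ τ ≠ σ, ∑ i, U i (τ i) < ∑ i, U i (σ i) := by
    intro τ hτ
    refine lt_of_le_of_ne ?_ fun h => hU ⟨τ, σ, hτ, h.trans hσ.symm, hσ.symm⟩
    rw [← hσ]
    exact Finset.le_sup' (fun σ : Equiv.Perm (Fin k) => ∑ i, U i (σ i)) (Finset.mem_univ τ)
  refine ⟨∑ i, U i (σ i), Equiv.Perm.sign σ = 1, fun A hA hAU => ?_⟩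
  let g : Equiv.Perm (Fin k) → HahnField := fun τ =>
    ((Equiv.Perm.sign τ : ℤ) : HahnField) * ∏ i, A i (τ i)
  have hp : ∀ τ : Equiv.Perm (Fin k), 0 < ∏ i, A i (τ i) := fun τ =>
    Finset.prod_pos fun i _ => hA _ _
  have hsg : ∀ τ : Equiv.Perm (Fin k), g τ = ∏ i, A i (τ i) ∧ Equiv.Perm.sign τ = 1 ∨
      g τ = -∏ i, A i (τ i) ∧ Equiv.Perm.sign τ ≠ 1 := by
    intro τ
    rcases Int.units_eq_one_or (Equiv.Perm.sign τ) with h | h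
    · left; simp [g, h]
    · right; simp [g, h]
  have hg : ∀ τ, g τ ≠ 0 := fun τ => by
    rcases hsg τ with h | h <;> rw [h.1]
    · exact (hp τ).ne'
    · exact neg_ne_zero.2 (hp τ).ne'
  have hv : ∀ τ, val (g τ) = ∑ i, U i (τ i) := fun τ => by
    have : val (∏ i, A i (τ i)) = ∑ i, U i (τ i) := by
      rw [val_prod _ _ fun i _ => (hA _ _).ne']
      exact Finset.sum_congr rfl fun i _ => hAU _ _
    rcases hsg τ with h | h <;> rw [h.1]
    · exact this
    · rw [val_neg, this]
  have hdet : A.det = ∑ τ, g τ := by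
    -- The Leibniz formula permutes row indices while the tropical permanent permutes column
    -- indices, hence the transpose.
    rw [← Matrix.det_transpose, Matrix.det_apply']
    rfl
  have := sign_and_val_of_close (sum_dominated Finset.univ g (Finset.mem_univ σ) hg
    fun τ _ hτ => by rw [hv, hv]; exact hlt τ hτ)
  rw [← hdet, hv] at this
  refine ⟨this.1, this.2.1.trans ?_, this.2.2⟩
  rcases hsg σ with h | h <;> rw [h.1]
  · exact ⟨fun _ => h.2, fun _ => hp σ⟩
  · exact ⟨fun h' => absurd h' (neg_neg_of_pos (hp σ)).asymm, fun h' => absurd h' h.2⟩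

/-! ### General position -/

theorem tropicallySingular_iff {k : ℕ} (U : Matrix (Fin k) (Fin k) ℝ) :
    TropicallySingular U ↔ ∃ σ τ : Equiv.Perm (Fin k), σ ≠ τ ∧
      (∀ ρ : Equiv.Perm (Fin k), ∑ i, U i (ρ i) ≤ ∑ i, U i (σ i)) ∧
      ∀ ρ : Equiv.Perm (Fin k), ∑ i, U i (ρ i) ≤ ∑ i, U i (τ i) := by
  have h : ∀ σ : Equiv.Perm (Fin k), ∑ i, U i (σ i) = tper U ↔
      ∀ ρ : Equiv.Perm (Fin k), ∑ i, U i (ρ i) ≤ ∑ i, U i (σ i) := by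
    intro σ
    have hle : ∑ i, U i (σ i) ≤ tper U :=
      Finset.le_sup' (fun σ : Equiv.Perm (Fin k) => ∑ i, U i (σ i)) (Finset.mem_univ σ)
    rw [le_antisymm_iff, and_iff_right hle, tper, Finset.sup'_le_iff]
    simp
  simp only [TropicallySingular, h]

/-- Tropical singularity is invariant under permuting the columns and adding constants to them. -/
theorem TropicallySingular.of_columns {k : ℕ} {U : Matrix (Fin k) (Fin k) ℝ}
    (π : Equiv.Perm (Fin k)) (d : Fin k → ℝ)
    (h : TropicallySingular (Matrix.of fun i j => U i (π j) + d j)) : TropicallySingular U := by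
  rw [tropicallySingular_iff] at h ⊢
  -- The column constants contribute the same total to every permutation, so composition with `π`
  -- matches the maximizers.
  have hs : ∀ ρ : Equiv.Perm (Fin k),
      ∑ i, (Matrix.of fun i j => U i (π j) + d j) i (ρ i) =
        ∑ i, U i ((ρ.trans π) i) + ∑ i, d i := fun ρ => by
    simp [Finset.sum_add_distrib, Equiv.sum_comp ρ d]
  obtain ⟨σ, τ, hne, hσ, hτ⟩ := h
  have key : ∀ σ : Equiv.Perm (Fin k),
      (∀ ρ : Equiv.Perm (Fin k), ∑ i, (Matrix.of fun i j => U i (π j) + d j) i (ρ i) ≤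
        ∑ i, (Matrix.of fun i j => U i (π j) + d j) i (σ i)) →
      ∀ ρ : Equiv.Perm (Fin k), ∑ i, U i (ρ i) ≤ ∑ i, U i ((σ.trans π) i) := by
    intro σ hσ ρ
    have := hσ (ρ.trans π.symm)
    rw [hs, hs, Equiv.trans_assoc, Equiv.symm_trans_self, Equiv.trans_refl] at this
    linarith
  refine ⟨σ.trans π, τ.trans π, fun h => hne ?_, key σ hσ, key τ hτ⟩
  ext i
  exact congrArg Fin.val (π.injective (Equiv.congr_fun h i))

/-- General position does not depend on the order of the points and the choice of homogeneous
coordinates. -/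
theorem GeneralPosition.not_tropicallySingular {n p k : ℕ} {v V : Fin p → Fin n → ℝ}
    (hv : GeneralPosition v) {c : Fin p → ℝ} (hV : ∀ r i, V r i = v r i + c r)
    (row : Fin k ↪o Fin n) {col : Fin k → Fin p} (hcol : Function.Injective col) :
    ¬ TropicallySingular (Matrix.of fun i j => V (col j) (row i)) := by
  classical
  have hcard : (Finset.univ.image col).card = k := by
    rw [Finset.card_image_of_injective _ hcol, Finset.card_fin]
  -- General position speaks of increasing column choices only; an injective choice is an increasing
  -- one followed by a permutation `π`.
  let emb := (Finset.univ.image col).orderEmbOfFin hcard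
  have hex : ∀ j, ∃ j', emb j' = col j := fun j => by
    have : col j ∈ Set.range emb := by
      rw [Finset.range_orderEmbOfFin]
      simp
    exact this
  choose π hπ using hex
  have hinj : Function.Injective π := fun a b hab => hcol (by rw [← hπ, ← hπ, hab])
  intro h
  refine hv k row emb (TropicallySingular.of_columns
    (Equiv.ofBijective π (Finite.injective_iff_bijective.1 hinj)) (fun j => c (col j)) ?_)
  convert h using 4 with i j
  simp [hπ, hV]

/-! ### The normal vector of a hyperplane -/

/-- The matrix with columns `x, u 1, …, u m`. -/
def consMatrix {m : ℕ} (x : Fin (m + 1) → HahnField) (u : Fin m → Fin (m + 1) → HahnField) :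
    Matrix (Fin (m + 1)) (Fin (m + 1)) HahnField :=
  Matrix.of fun i j => (Fin.cons x u : Fin (m + 1) → Fin (m + 1) → HahnField) j i

/-- The vector of signed maximal minors, a normal vector of the hyperplane through
`u 1, …, u m`. -/
noncomputable def normal {m : ℕ} (u : Fin m → Fin (m + 1) → HahnField) : Fin (m + 1) → HahnField :=
  fun i => (-1) ^ (i : ℕ) * (Matrix.of fun j k => u k (i.succAbove j)).det

/-- Laplace expansion along the first column. It turns the side of the hyperplane on which `x` lies
into the sign of a determinant, to which general position applies. -/
theorem sum_normal_mul {m : ℕ} (x : Fin (m + 1) → HahnField)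
    (u : Fin m → Fin (m + 1) → HahnField) :
    ∑ i, normal u i * x i = (consMatrix x u).det := by
  rw [Matrix.det_succ_column_zero]
  refine Finset.sum_congr rfl fun i _ => ?_
  have : (consMatrix x u).submatrix i.succAbove Fin.succ =
      Matrix.of fun j k => u k (i.succAbove j) := by
    ext j k
    simp [consMatrix]
  rw [this, normal]
  simp [consMatrix]
  ring

theorem sum_normal_mul_self {m : ℕ} (u : Fin m → Fin (m + 1) → HahnField) (k : Fin m) :
    ∑ i, normal u i * u k i = 0 := by
  rw [sum_normal_mul]
  refine Matrix.det_zero_of_column_eq (i := 0) (j := k.succ) (Fin.succ_ne_zero k).symm fun i => ?_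
  simp [consMatrix]

/-- The vectors orthogonal to `u 1, …, u m` are the multiples of `normal u`. -/
theorem eq_mul_normal {m : ℕ} {u : Fin m → Fin (m + 1) → HahnField} (h0 : normal u 0 ≠ 0)
    {g : Fin (m + 1) → HahnField} (hg : ∀ k, ∑ i, g i * u k i = 0) :
    ∃ κ, ∀ i, g i = κ * normal u i := by
  refine ⟨g 0 / normal u 0, fun i => ?_⟩
  -- Subtracting this multiple of the normal kills coordinate `0`. The other coordinates then solve
  -- a square system whose determinant is, up to sign, `normal u 0`.
  let h : Fin (m + 1) → HahnField := fun i => g i - g 0 / normal u 0 * normal u i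
  have hh0 : h 0 = 0 := by simp [h, h0]
  have hh : ∀ k, ∑ i, h i * u k i = 0 := fun k => by
    simp only [h, sub_mul, Finset.sum_sub_distrib, hg, mul_assoc, ← Finset.mul_sum,
      sum_normal_mul_self, mul_zero, sub_zero]
  have hdet : (Matrix.of fun j k => u k ((0 : Fin (m + 1)).succAbove j)).det ≠ 0 := fun hd =>
    h0 (by rw [normal, hd, mul_zero])
  have hz : (fun j : Fin m => h j.succ) = 0 := by
    refine Matrix.eq_zero_of_vecMul_eq_zero hdet ?_
    ext k
    have := hh k
    rw [Fin.sum_univ_succ, hh0, zero_mul, zero_add] at this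
    simpa [Matrix.vecMul, dotProduct] using this
  have : h i = 0 := by
    refine Fin.cases hh0 (fun j => ?_) i
    exact congrFun hz j
  exact sub_eq_zero.1 this

/-- The signs and the valuations of the coordinates of the normal vector, and its position with
respect to the other points, are the same for all lifts. -/
theorem GeneralPosition.normal_of_lift {m p : ℕ} {v V : Fin p → Fin (m + 1) → ℝ}
    (hv : GeneralPosition v) {c : Fin p → ℝ} (hV : ∀ r i, V r i = v r i + c r)
    {e : Fin m → Fin p} (he : Function.Injective e)
    {w w' : Fin p → Fin (m + 1) → HahnField} (hw : ∀ r i, 0 < w r i) (hw' : ∀ r i, 0 < w' r i)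
    (hwV : ∀ r i, val (w r i) = V r i) (hwV' : ∀ r i, val (w' r i) = V r i) :
    (∀ i, normal (w ∘ e) i ≠ 0 ∧ (0 < normal (w ∘ e) i ↔ 0 < normal (w' ∘ e) i) ∧
      val (normal (w ∘ e) i) = val (normal (w' ∘ e) i)) ∧
    ∀ s ∉ Set.range e, ∑ i, normal (w ∘ e) i * w s i ≠ 0 ∧
      (0 < ∑ i, normal (w ∘ e) i * w s i ↔ 0 < ∑ i, normal (w' ∘ e) i * w' s i) := by
  constructor
  · intro i
    obtain ⟨c, P, h⟩ := exists_sign_and_val_det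
      (hv.not_tropicallySingular hV (Fin.succAboveOrderEmb i) he)
    obtain ⟨h1, h2, h3⟩ := h (Matrix.of fun j k => (w ∘ e) k (i.succAbove j))
      (fun _ _ => hw _ _) (fun _ _ => hwV _ _)
    obtain ⟨h1', h2', h3'⟩ := h (Matrix.of fun j k => (w' ∘ e) k (i.succAbove j))
      (fun _ _ => hw' _ _) (fun _ _ => hwV' _ _)
    rw [normal, normal]
    rcases neg_one_pow_eq_or HahnField (i : ℕ) with hi | hi
    · rw [hi, one_mul, one_mul]
      exact ⟨h1, h2.trans h2'.symm, h3.trans h3'.symm⟩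
    · rw [hi, neg_one_mul, neg_one_mul, val_neg, val_neg, neg_pos, neg_pos, ← not_le, ← not_le,
        h1.symm.le_iff_lt, h1'.symm.le_iff_lt, h2, h2']
      exact ⟨neg_ne_zero.2 h1, Iff.rfl, h3.trans h3'.symm⟩
  · intro s hs
    have hinj : Function.Injective (Fin.cons s e : Fin (m + 1) → Fin p) :=
      Fin.cons_injective_iff.2 ⟨hs, he⟩
    have hcons : ∀ w : Fin p → Fin (m + 1) → HahnField, consMatrix (w s) (w ∘ e) =
        Matrix.of fun i j => w ((Fin.cons s e : Fin (m + 1) → Fin p) j) i := by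
      intro w
      ext i j
      refine Fin.cases ?_ (fun j => ?_) j <;> simp [consMatrix]
    obtain ⟨c, P, h⟩ := exists_sign_and_val_det
      (hv.not_tropicallySingular hV (RelEmbedding.refl _) hinj)
    rw [sum_normal_mul, sum_normal_mul, hcons, hcons]
    obtain ⟨h1, h2, -⟩ := h (Matrix.of fun i j => w ((Fin.cons s e : Fin (m + 1) → Fin p) j) i)
      (fun _ _ => hw _ _) (fun _ _ => hwV _ _)
    obtain ⟨-, h2', -⟩ := h (Matrix.of fun i j => w' ((Fin.cons s e : Fin (m + 1) → Fin p) j) i)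
      (fun _ _ => hw' _ _) (fun _ _ => hwV' _ _)
    exact ⟨h1, h2.trans h2'.symm⟩

/-! ### Tropical half-spaces and half-spaces over the Hahn field -/

/-- If a linear form is non-negative at a lift of `y`, then `y` lies in the corresponding tropical
half-space. -/
theorem exists_val_le_of_sum_nonneg {n : ℕ} {f x : Fin n → HahnField} (hx : ∀ i, 0 < x i)
    (h : 0 ≤ ∑ i, f i * x i) {j : Fin n} (hj : f j < 0) :
    ∃ i, 0 < f i ∧ val (f j) + val (x j) ≤ val (f i) + val (x i) := by
  by_contra! hcon
  have hjx : 0 < -(f j * x j) := neg_pos.2 (mul_neg_of_neg_of_pos hj (hx j))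
  have hn : 0 < (n : HahnField) := by exact_mod_cast j.pos
  -- If all positive terms had smaller valuation than term `j`, then even `n` times any of them
  -- would not exceed `-(f j * x j)`; the `n - 1` terms other than `j` could not compensate it.
  have hle : ∀ i, n * (f i * x i) ≤ -(f j * x j) := by
    intro i
    rcases lt_or_ge 0 (f i) with hi | hi
    · have hlt : val (f i * x i) < val (-(f j * x j)) := by
        rw [val_neg, val_mul hi.ne' (hx i).ne', val_mul hj.ne (hx j).ne']
        exact hcon i hi
      have := (val_lt_val_iff (mul_pos hi (hx i)).ne' hjx.ne').1 hlt n
      rw [abs_of_pos (mul_pos hi (hx i)), abs_of_pos hjx] at this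
      exact this.le
    · exact (mul_nonpos_of_nonneg_of_nonpos hn.le
        (mul_nonpos_of_nonpos_of_nonneg hi (hx i).le)).trans hjx.le
  have hsum : ∑ i ∈ Finset.univ.erase j, n * (f i * x i) ≤ (n - 1 : ℕ) * (-(f j * x j)) := by
    refine (Finset.sum_le_card_nsmul _ _ _ fun i _ => hle i).trans_eq ?_
    rw [Finset.card_erase_of_mem (Finset.mem_univ j), Finset.card_fin, nsmul_eq_mul]
  rw [← Finset.mul_sum, Finset.sum_erase_eq_sub (Finset.mem_univ j)] at hsum
  have hlt : ((n - 1 : ℕ) : HahnField) * -(f j * x j) < n * -(f j * x j) :=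
    mul_lt_mul_of_pos_right (by exact_mod_cast Nat.sub_lt j.pos one_pos) hjx
  have := lt_of_mul_lt_mul_left (hsum.trans_lt hlt) hn.le
  linarith

/-- Every point of a tropical half-space lifts to the corresponding half-space. -/
theorem exists_lift_sum_nonneg {n : ℕ} {f : Fin n → HahnField} {y : Fin n → ℝ}
    (hpos : ∃ i, 0 < f i)
    (h : ∀ j, f j < 0 → ∃ i, 0 < f i ∧ val (f j) + y j ≤ val (f i) + y i) :
    ∃ x : Fin n → HahnField, (∀ i, 0 < x i) ∧ (∀ i, val (x i) = y i) ∧ 0 ≤ ∑ i, f i * x i := by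
  classical
  choose u hu huy using fun i => exists_pos_val_eq (y i)
  obtain ⟨i₀, hi₀, hmax⟩ := Finset.exists_max_image (Finset.univ.filter fun i => 0 < f i)
    (fun i => val (f i) + y i) (by obtain ⟨i, hi⟩ := hpos; exact ⟨i, by simpa using hi⟩)
  rw [Finset.mem_filter_univ] at hi₀
  have hex : ∀ j, ∃ k : ℕ, -(f j * u j) ≤ k * (f i₀ * u i₀) := by
    intro j
    rcases lt_or_ge (f j) 0 with hj | hj
    · obtain ⟨i, hi, hji⟩ := h j hj
      have hle : val (f j * u j) ≤ val (f i₀ * u i₀) := by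
        rw [val_mul hj.ne (hu j).ne', val_mul hi₀.ne' (hu i₀).ne', huy, huy]
        exact hji.trans (hmax i (by simpa using hi))
      obtain ⟨k, hk⟩ := (val_le_val_iff (mul_neg_of_neg_of_pos hj (hu j)).ne
        (mul_pos hi₀ (hu i₀)).ne').1 hle
      rw [abs_of_pos (mul_pos hi₀ (hu i₀))] at hk
      exact ⟨k, (neg_le_abs _).trans hk⟩
    · refine ⟨0, ?_⟩
      rw [Nat.cast_zero, zero_mul, neg_nonpos]
      exact mul_nonneg hj (hu j).le
  choose k hk using hex
  -- Coordinate `i₀` carries the dominant positive term. One copy of it is its own term, and `k j`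
  -- further copies pay for term `j`.
  refine ⟨fun i => if i = i₀ then ((∑ j, k j + 1 : ℕ) : HahnField) * u i₀ else u i, ?_, ?_, ?_⟩
  · intro i
    dsimp only
    split_ifs with hi
    · exact mul_pos (by exact_mod_cast Nat.succ_pos _) (hu i₀)
    · exact hu i
  · intro i
    dsimp only
    split_ifs with hi
    · rw [hi, val_natCast_mul (Nat.succ_ne_zero _) (hu i₀).ne', huy]
    · exact huy i
  · have hsum : ∑ i, f i * (if i = i₀ then ((∑ j, k j + 1 : ℕ) : HahnField) * u i₀ else u i) =
        ∑ i, (f i * u i + k i * (f i₀ * u i₀)) := by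
      have : ∀ i, f i * (if i = i₀ then ((∑ j, k j + 1 : ℕ) : HahnField) * u i₀ else u i) =
          f i * u i + if i = i₀ then ((∑ j, k j : ℕ) : HahnField) * (f i₀ * u i₀) else 0 := by
        intro i
        split_ifs with hi
        · subst hi
          push_cast
          ring
        · rw [add_zero]
      simp_rw [this, Finset.sum_add_distrib, Finset.sum_ite_eq', if_pos (Finset.mem_univ i₀)]
      rw [← Finset.sum_mul, Nat.cast_sum]
    rw [hsum]
    exact Finset.sum_nonneg fun i _ => by linarith [hk i]

/-- The combination lies between `x` and `y`, and `val` is monotone on positive elements. Thus the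
positive lifts of a fixed tropical point form a convex set. -/
theorem val_convexComb {a b x y : HahnField} {c : ℝ} (ha : 0 ≤ a) (hb : 0 ≤ b) (hab : a + b = 1)
    (hx : 0 < x) (hy : 0 < y) (hxc : val x = c) (hyc : val y = c) :
    0 < a * x + b * y ∧ val (a * x + b * y) = c := by
  have key : ∀ {a b x y : HahnField}, 0 ≤ a → 0 ≤ b → a + b = 1 → 0 < x → x ≤ y →
      val x = c → val y = c → 0 < a * x + b * y ∧ val (a * x + b * y) = c := by
    intro a b x y ha hb hab hx hxy hxc hyc
    have h1 : x ≤ a * x + b * y := by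
      calc x = a * x + b * x := by rw [← add_mul, hab, one_mul]
        _ ≤ a * x + b * y := by gcongr
    have h2 : a * x + b * y ≤ y := by
      calc a * x + b * y ≤ a * y + b * y := by gcongr
        _ = y := by rw [← add_mul, hab, one_mul]
    exact ⟨hx.trans_le h1, le_antisymm (hyc ▸ val_mono (hx.trans_le h1) h2)
      (hxc ▸ val_mono hx h1)⟩
  rcases le_total x y with h | h
  · exact key ha hb hab hx h hxc hyc
  · rw [add_comm]
    exact key hb ha (by rwa [add_comm]) hy h hyc hxc

/-- Every point of the boundary of a tropical half-space lifts to the corresponding hyperplane. -/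
theorem exists_lift_sum_eq_zero {n : ℕ} {f : Fin n → HahnField} {y : Fin n → ℝ}
    (hpos : ∃ i, 0 < f i) (hneg : ∃ i, f i < 0)
    (h : ∀ j, f j < 0 → ∃ i, 0 < f i ∧ val (f j) + y j ≤ val (f i) + y i)
    (h' : ∀ j, 0 < f j → ∃ i, f i < 0 ∧ val (f j) + y j ≤ val (f i) + y i) :
    ∃ x : Fin n → HahnField, (∀ i, 0 < x i) ∧ (∀ i, val (x i) = y i) ∧ ∑ i, f i * x i = 0 := by
  obtain ⟨x₁, hx₁, hy₁, hs₁⟩ := exists_lift_sum_nonneg hpos h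
  obtain ⟨x₂, hx₂, hy₂, hs₂⟩ := exists_lift_sum_nonneg (f := fun i => -f i) (y := y)
    (by simpa using hneg) (by simpa [val_neg] using h')
  simp only [neg_mul, Finset.sum_neg_distrib] at hs₂
  rcases hs₁.eq_or_lt with h0 | hlt
  · exact ⟨x₁, hx₁, hy₁, h0.symm⟩
  set α := ∑ i, f i * x₁ i
  set β := ∑ i, f i * x₂ i
  have hd : 0 < α - β := by linarith
  -- The two lifts lie on opposite sides of the hyperplane; these weights give the point where their
  -- segment meets it.
  have hconv : ∀ i, 0 < -β / (α - β) * x₁ i + α / (α - β) * x₂ i ∧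
      val (-β / (α - β) * x₁ i + α / (α - β) * x₂ i) = y i := fun i =>
    val_convexComb (div_nonneg hs₂ hd.le) (div_nonneg hs₁ hd.le)
      (by rw [← add_div, div_eq_one_iff_eq hd.ne']; ring) (hx₁ i) (hx₂ i) (hy₁ i) (hy₂ i)
  refine ⟨fun i => -β / (α - β) * x₁ i + α / (α - β) * x₂ i, fun i => (hconv i).1,
    fun i => (hconv i).2, ?_⟩
  have : ∑ i, f i * (-β / (α - β) * x₁ i + α / (α - β) * x₂ i) =
      -β / (α - β) * α + α / (α - β) * β := by
    simp only [α, β, mul_add, Finset.sum_add_distrib, Finset.mul_sum]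
    congr 1 <;> exact Finset.sum_congr rfl fun i _ => by ring
  rw [this]
  ring

/-! ### Tropical half-spaces in homogeneous coordinates -/

/-- The tropical half-space with apex `a` in homogeneous coordinates. -/
def InHalfSpace {n : ℕ} (a : Fin n → ℝ) (I : Finset (Fin n)) (y : Fin n → ℝ) : Prop :=
  ∀ j ∉ I, ∃ i ∈ I, y j - a j ≤ y i - a i

theorem toTP_eq_toTP_iff {n : ℕ} {x y : Fin n → ℝ} :
    toTP x = toTP y ↔ ∃ c : ℝ, ∀ i, x i = y i + c := by
  rw [toTP, toTP, Submodule.Quotient.eq, Submodule.mem_span_singleton]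
  refine exists_congr fun c => ?_
  rw [funext_iff]
  refine forall_congr' fun i => ?_
  simp only [Pi.smul_apply, Pi.sub_apply, smul_eq_mul, mul_one]
  constructor <;> intro h <;> linarith

theorem InHalfSpace.of_add_const {n : ℕ} {a : Fin n → ℝ} {I : Finset (Fin n)} {x y : Fin n → ℝ}
    (h : InHalfSpace a I x) {c : ℝ} (hc : ∀ i, x i = y i + c) : InHalfSpace a I y := by
  intro j hj
  obtain ⟨i, hi, hle⟩ := h j hj
  rw [hc, hc] at hle
  exact ⟨i, hi, by linarith⟩

theorem toTP_mem_tropicalHalfSpace {n : ℕ} {a : Fin n → ℝ} {I : Finset (Fin n)}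
    {y : Fin n → ℝ} : toTP y ∈ tropicalHalfSpace a I ↔ InHalfSpace a I y := by
  have h : ∀ x : Fin n → ℝ, (Iᶜ.sup fun j => ((x j - a j : ℝ) : WithBot ℝ)) ≤
      (I.sup fun i => ((x i - a i : ℝ) : WithBot ℝ)) ↔ InHalfSpace a I x := by
    intro x
    rw [Finset.sup_le_iff]
    refine forall_congr' fun j => ?_
    rw [Finset.mem_compl, Finset.le_sup_iff (WithBot.bot_lt_coe _)]
    simp only [WithBot.coe_le_coe]
  constructor
  · rintro ⟨x, hx, hxy⟩
    obtain ⟨c, hc⟩ := toTP_eq_toTP_iff.1 hxy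
    exact ((h x).1 hx).of_add_const hc
  · exact fun hy => ⟨y, (h y).2 hy, rfl⟩

theorem tropicalPolytope_subset_tropicalHalfSpace_iff {n p : ℕ} {v : Fin p → Fin n → ℝ}
    {a : Fin n → ℝ} {I : Finset (Fin n)} :
    tropicalPolytope v ⊆ tropicalHalfSpace a I ↔ ∀ r, InHalfSpace a I (v r) := by
  constructor
  · intro h r
    refine toTP_mem_tropicalHalfSpace.1 (h ⟨v r, ?_, rfl⟩)
    -- All coefficients have to be real, so the other generators get coefficients low enough never
    -- to exceed `v r` in any coordinate.
    have hb : ∀ s, ∃ b : ℝ, ∀ i, b ≤ v r i - v s i := fun s => by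
      obtain ⟨b, hb⟩ := (Set.finite_range fun i => v r i - v s i).bddBelow
      exact ⟨b, fun i => hb ⟨i, rfl⟩⟩
    choose b hb using hb
    refine ⟨fun s => if s = r then 0 else b s, fun i => le_antisymm ?_ (Finset.sup_le fun s _ => ?_)⟩
    · refine le_trans ?_ (Finset.le_sup (Finset.mem_univ r))
      simp
    · rw [WithBot.coe_le_coe]
      dsimp only
      split_ifs with hs
      · rw [hs, zero_add]
      · linarith [hb s i]
  · rintro h _ ⟨x, ⟨l, hx⟩, rfl⟩
    refine toTP_mem_tropicalHalfSpace.2 fun j hj => ?_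
    obtain ⟨r, -, hr⟩ := (Finset.le_sup_iff (WithBot.bot_lt_coe _)).1 (hx j).le
    rw [WithBot.coe_le_coe] at hr
    obtain ⟨i, hi, hle⟩ := h r j hj
    have hi' : ((l r + v r i : ℝ) : WithBot ℝ) ≤ x i := by
      rw [hx i]
      exact Finset.le_sup (f := fun r => ((l r + v r i : ℝ) : WithBot ℝ)) (Finset.mem_univ r)
    rw [WithBot.coe_le_coe] at hi'
    exact ⟨i, hi, by linarith⟩

theorem isClosed_setOf_inHalfSpace {n : ℕ} (a : Fin n → ℝ) (I : Finset (Fin n)) :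
    IsClosed {y | InHalfSpace a I y} := by
  have : {y | InHalfSpace a I y} =
      ⋂ j ∈ {j | j ∉ I}, ⋃ i ∈ I, {y : Fin n → ℝ | y j - a j ≤ y i - a i} := by
    ext y
    simp [InHalfSpace]
  rw [this]
  refine isClosed_biInter fun j _ => I.finite_toSet.isClosed_biUnion fun i _ => ?_
  exact isClosed_le (by fun_prop) (by fun_prop)

/-- The boundary of a tropical half-space consists of the points where both maxima are equal. -/
theorem toTP_mem_frontier_tropicalHalfSpace {n : ℕ} {a : Fin n → ℝ} {I : Finset (Fin n)}
    (hI : I.Nonempty) {y : Fin n → ℝ} :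
    toTP y ∈ frontier (tropicalHalfSpace a I) ↔ InHalfSpace a I y ∧ InHalfSpace a Iᶜ y := by
  have hopen : IsOpenQuotientMap (toTP : (Fin n → ℝ) → TP n) :=
    Submodule.isOpenQuotientMap_mkQ (Submodule.span ℝ {(fun _ => 1 : Fin n → ℝ)})
  have hpre : toTP ⁻¹' tropicalHalfSpace a I = {y | InHalfSpace a I y} :=
    Set.ext fun y => toTP_mem_tropicalHalfSpace
  rw [← Set.mem_preimage,
    hopen.isOpenMap.preimage_frontier_eq_frontier_preimage hopen.continuous, hpre,
    (isClosed_setOf_inHalfSpace a I).frontier_eq, Set.mem_sdiff, Set.mem_ofPred_eq]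
  refine and_congr_right fun hy => ⟨fun hint => ?_, fun hy' hint => ?_⟩
  · by_contra hcon
    simp only [InHalfSpace, Finset.mem_compl, not_not, not_forall, not_exists, not_and,
      not_le] at hcon
    obtain ⟨i, hi, hlt⟩ := hcon
    -- If coordinate `i` in `I` strictly beats all coordinates outside `I`, it still does so nearby,
    -- and the point is interior.
    refine hint (mem_interior.2 ⟨⋂ j ∈ {j | j ∉ I}, {z : Fin n → ℝ | z j - a j < z i - a i},
      fun z hz j hj => ⟨i, hi, (Set.mem_iInter₂.1 hz j hj).le⟩, ?_, ?_⟩)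
    · exact (Set.toFinite _).isOpen_biInter fun j _ => isOpen_lt (by fun_prop) (by fun_prop)
    · exact Set.mem_iInter₂.2 hlt
  -- When both maxima agree, lowering the coordinates in `I` by an arbitrarily small `ε > 0` leaves
  -- the half-space.
  · have hcont : Continuous fun ε : ℝ => fun i => if i ∈ I then y i - ε else y i := by
      refine continuous_pi fun i => ?_
      split_ifs <;> fun_prop
    have hmem : ∀ᶠ ε in nhds (0 : ℝ),
        (fun i => if i ∈ I then y i - ε else y i) ∈ {y | InHalfSpace a I y} := by
      refine hcont.continuousAt.eventually (mem_interior_iff_mem_nhds.1 ?_)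
      have hzero : (fun i => if i ∈ I then y i - 0 else y i) = y := by
        ext i
        simp
      dsimp only
      rw [hzero]
      exact hint
    obtain ⟨ε, hin, hε⟩ := ((hmem.filter_mono nhdsWithin_le_nhds).and
      (self_mem_nhdsWithin (s := Set.Ioi (0 : ℝ)))).exists
    obtain ⟨i₀, hi₀, hmax⟩ := Finset.exists_max_image I (fun i => y i - a i) hI
    obtain ⟨j, hj, hle⟩ := hy' i₀ (by simpa using hi₀)
    obtain ⟨i, hi, hji⟩ := hin j (Finset.mem_compl.1 hj)
    simp only [if_neg (Finset.mem_compl.1 hj), if_pos hi] at hji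
    linarith [hmax i hi, show 0 < ε from hε]

/-! ### Facets -/

theorem inHalfSpace_val_of_sum_nonneg {n : ℕ} {f x : Fin n → HahnField} (hf : ∀ i, f i ≠ 0)
    (hx : ∀ i, 0 < x i) (h : 0 ≤ ∑ i, f i * x i) {a : Fin n → ℝ} {I : Finset (Fin n)}
    (hI : ∀ i, 0 < f i ↔ i ∈ I) (ha : ∀ i, val (f i) = -a i) :
    InHalfSpace a I fun i => val (x i) := by
  intro j hj
  have hj' : f j < 0 := lt_of_le_of_ne (not_lt.1 fun h => hj ((hI j).1 h)) (hf j)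
  obtain ⟨i, hi, hle⟩ := exists_val_le_of_sum_nonneg hx h hj'
  rw [ha, ha] at hle
  exact ⟨i, (hI i).1 hi, by linarith⟩

theorem InHalfSpace.exists_val_le {n : ℕ} {f : Fin n → HahnField} {a y : Fin n → ℝ}
    {I : Finset (Fin n)} (h : InHalfSpace a I y) (hI : ∀ i, 0 < f i ↔ i ∈ I)
    (ha : ∀ i, val (f i) = -a i) (j : Fin n) (hj : f j < 0) :
    ∃ i, 0 < f i ∧ val (f j) + y j ≤ val (f i) + y i := by
  obtain ⟨i, hi, hle⟩ := h j fun hjI => hj.asymm ((hI j).2 hjI)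
  refine ⟨i, (hI i).2 hi, ?_⟩
  rw [ha, ha]
  linarith

/-- The image under the valuation of a half-space is a tropical half-space. -/
theorem valImage_setOf_sum_nonneg {n : ℕ} {f : Fin n → HahnField} (hf : ∀ i, f i ≠ 0)
    {a : Fin n → ℝ} {I : Finset (Fin n)} (hne : I.Nonempty)
    (hI : ∀ i, 0 < f i ↔ i ∈ I) (ha : ∀ i, val (f i) = -a i) :
    valImage {x | 0 ≤ ∑ i, f i * x i} = tropicalHalfSpace a I := by
  ext z
  constructor
  · rintro ⟨x, ⟨hx, hpos⟩, rfl⟩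
    exact toTP_mem_tropicalHalfSpace.2 (inHalfSpace_val_of_sum_nonneg hf hpos hx hI ha)
  · intro hz
    obtain ⟨y, rfl⟩ := Submodule.Quotient.mk_surjective _ z
    have hy := toTP_mem_tropicalHalfSpace.1 hz
    obtain ⟨x, hx, hxy, hs⟩ := exists_lift_sum_nonneg (f := f) (y := y)
      (hne.imp fun i hi => (hI i).2 hi) (hy.exists_val_le hI ha)
    exact ⟨x, ⟨hs, hx⟩, congrArg toTP (funext hxy)⟩

/-- A tropical half-space which contains all the points and has `m` of them on its boundary lifts
to a half-space which contains the lifts of all the points and has the lifts of exactly those `m`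
points on its boundary. -/
theorem GeneralPosition.exists_lift_halfSpace {m p : ℕ} {v V : Fin p → Fin (m + 1) → ℝ}
    (hv : GeneralPosition v) {c : Fin p → ℝ} (hV : ∀ r i, V r i = v r i + c r)
    {e : Fin m → Fin p} (he : Function.Injective e)
    {w : Fin p → Fin (m + 1) → HahnField} (hw : ∀ r i, 0 < w r i)
    (hwV : ∀ r i, val (w r i) = V r i) {a : Fin (m + 1) → ℝ} {I : Finset (Fin (m + 1))}
    (hI : I.Nonempty) (hI' : Iᶜ.Nonempty) (h : ∀ r, InHalfSpace a I (V r))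
    (h' : ∀ k, InHalfSpace a Iᶜ (V (e k))) :
    ∃ f : Fin (m + 1) → HahnField, (∀ i, f i ≠ 0) ∧ (∀ i, 0 < f i ↔ i ∈ I) ∧
      (∀ i, val (f i) = -a i) ∧ (∀ k, ∑ i, f i * w (e k) i = 0) ∧
      ∀ s ∉ Set.range e, 0 < ∑ i, f i * w s i := by
  choose T hT hTa using fun i => exists_pos_val_eq (-a i)
  -- Any form with sign pattern `I` and valuations `-a` will do; it need not vanish on the given
  -- lifts `w (e k)`.
  let g : Fin (m + 1) → HahnField := fun i => if i ∈ I then T i else -T i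
  have hgpos : ∀ i, 0 < g i ↔ i ∈ I := fun i => by
    by_cases hi : i ∈ I <;> simp [g, hi, hT i, (hT i).le]
  have hgneg : ∀ i, g i < 0 ↔ i ∉ I := fun i => by
    by_cases hi : i ∈ I <;> simp [g, hi, hT i, (hT i).le]
  have hgval : ∀ i, val (g i) = -a i := fun i => by
    by_cases hi : i ∈ I <;> simp [g, hi, hTa i, val_neg]
  have hpos : ∃ i, 0 < g i := hI.imp fun i hi => (hgpos i).2 hi
  have hneg : ∃ i, g i < 0 := hI'.imp fun i hi => (hgneg i).2 (Finset.mem_compl.1 hi)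
  -- The points are lifted again, now adapted to `g`: the boundary points go onto its hyperplane,
  -- the others into its half-space.
  have hex : ∀ r, ∃ x : Fin (m + 1) → HahnField, (∀ i, 0 < x i) ∧ (∀ i, val (x i) = V r i) ∧
      0 ≤ ∑ i, g i * x i ∧ (r ∈ Set.range e → ∑ i, g i * x i = 0) := by
    intro r
    by_cases hr : r ∈ Set.range e
    · obtain ⟨k, rfl⟩ := hr
      obtain ⟨x, hx, hxy, hs⟩ := exists_lift_sum_eq_zero hpos hneg
        ((h (e k)).exists_val_le hgpos hgval) fun j hj => by
          obtain ⟨i, hi, hle⟩ := h' k j (by simpa using (hgpos j).1 hj)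
          refine ⟨i, (hgneg i).2 (Finset.mem_compl.1 hi), ?_⟩
          rw [hgval, hgval]
          linarith
      exact ⟨x, hx, hxy, hs.ge, fun _ => hs⟩
    · obtain ⟨x, hx, hxy, hs⟩ := exists_lift_sum_nonneg hpos ((h r).exists_val_le hgpos hgval)
      exact ⟨x, hx, hxy, hs, fun hr' => absurd hr' hr⟩
  choose w' hw' hwV' hnn hz using hex
  obtain ⟨h1, h2⟩ := hv.normal_of_lift hV he hw hw' hwV hwV'
  obtain ⟨h1', -⟩ := hv.normal_of_lift hV he hw' hw' hwV' hwV'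
  obtain ⟨κ, hκ⟩ := eq_mul_normal (h1' 0).1 (g := g) fun k => hz (e k) ⟨k, rfl⟩
  have hκ0 : κ ≠ 0 := by
    rintro rfl
    obtain ⟨i, hi⟩ := hpos
    rw [hκ, zero_mul] at hi
    exact lt_irrefl _ hi
  have hsign : ∀ {x y : HahnField}, x ≠ 0 → y ≠ 0 → (0 < x ↔ 0 < y) → (0 < κ * x ↔ 0 < κ * y) := by
    intro x y hx hy hxy
    rcases hx.lt_or_gt with hx | hx
    · have hy : y < 0 := hy.lt_or_gt.resolve_right fun h => hx.asymm (hxy.2 h)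
      simp only [mul_pos_iff, hx, hy, hx.asymm, hy.asymm]
    · rw [mul_pos_iff_of_pos_right hx, mul_pos_iff_of_pos_right (hxy.1 hx)]
  have hsum : ∀ (u : Fin m → Fin (m + 1) → HahnField) (x : Fin (m + 1) → HahnField),
      ∑ i, κ * normal u i * x i = κ * ∑ i, normal u i * x i := fun u x => by
    simp only [mul_assoc, Finset.mul_sum]
  -- The factor relating `g` to the normal of the adapted lift is reused for the normal of the
  -- original lift.
  refine ⟨fun i => κ * normal (w ∘ e) i, fun i => mul_ne_zero hκ0 (h1 i).1, fun i => ?_,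
    fun i => ?_, fun k => ?_, fun s hs => ?_⟩
  · rw [← hgpos, hκ]
    exact hsign (h1 i).1 (h1' i).1 (h1 i).2.1
  · rw [← hgval, hκ, val_mul hκ0 (h1 i).1, val_mul hκ0 (h1' i).1, (h1 i).2.2]
  · rw [hsum]
    exact mul_eq_zero_of_right _ (sum_normal_mul_self (w ∘ e) k)
  · have hne : ∑ i, normal (w' ∘ e) i * w' s i ≠ 0 :=
      ((hv.normal_of_lift hV he hw' hw' hwV' hwV').2 s hs).1
    rw [hsum, hsign (h2 s hs).1 hne (h2 s hs).2]
    -- The adapted lift only gives `≥`; general position excludes equality.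
    refine lt_of_le_of_ne ?_ (mul_ne_zero hκ0 hne).symm
    rw [← hsum]
    refine (hnn s).trans_eq (Finset.sum_congr rfl fun i _ => ?_)
    rw [hκ i]

/-- A linear form which is positive on the generators of a cone outside a subset, and zero on this
subset. -/
theorem nonneg_and_mem_hull_of_mem_hull {n : ℕ} {f : Fin n → HahnField}
    {S T : Set (Fin n → HahnField)} (h0 : ∀ x ∈ S, ∑ i, f i * x i = 0)
    (hpos : ∀ x ∈ T, x ∉ S → 0 < ∑ i, f i * x i) {x : Fin n → HahnField}
    (hx : x ∈ PointedCone.hull HahnField T) :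
    0 ≤ ∑ i, f i * x i ∧ (∑ i, f i * x i = 0 → x ∈ PointedCone.hull HahnField S) := by
  induction hx using Submodule.span_induction with
  | mem x hx =>
    by_cases hxS : x ∈ S
    · exact ⟨(h0 x hxS).ge, fun _ => PointedCone.subset_hull hxS⟩
    · exact ⟨(hpos x hx hxS).le, fun h => absurd h (hpos x hx hxS).ne'⟩
  | zero => exact ⟨by simp, fun _ => Submodule.zero_mem _⟩
  | add x y _ _ hx hy =>
    simp only [Pi.add_apply, mul_add, Finset.sum_add_distrib]
    exact ⟨add_nonneg hx.1 hy.1, fun h =>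
      Submodule.add_mem _ (hx.2 (by linarith [hx.1, hy.1])) (hy.2 (by linarith [hx.1, hy.1]))⟩
  | smul c x _ hx =>
    have hsum : ∑ i, f i * (c • x) i = c * ∑ i, f i * x i := by
      rw [Finset.mul_sum]
      refine Finset.sum_congr rfl fun i _ => ?_
      change f i * (c * x i) = _
      ring
    rw [hsum]
    refine ⟨mul_nonneg c.2 hx.1, fun h => ?_⟩
    rcases mul_eq_zero.1 h with hc | h
    · rw [show c = 0 from Subtype.ext hc, zero_smul]
      exact Submodule.zero_mem _
    · exact Submodule.smul_mem _ c (hx.2 h)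

theorem sum_eq_zero_of_mem_hull {n : ℕ} {f : Fin n → HahnField}
    {S : Set (Fin n → HahnField)} (h0 : ∀ x ∈ S, ∑ i, f i * x i = 0) {x : Fin n → HahnField}
    (hx : x ∈ PointedCone.hull HahnField S) : ∑ i, f i * x i = 0 := by
  have h := (nonneg_and_mem_hull_of_mem_hull h0 (fun x hx hx' => absurd hx hx') hx).1
  have h' := (nonneg_and_mem_hull_of_mem_hull (f := fun i => -f i) (by simpa using h0)
    (fun x hx hx' => absurd hx hx') hx).1
  simp only [neg_mul, Finset.sum_neg_distrib] at h'
  exact le_antisymm (neg_nonneg.1 h') h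

theorem span_hull {n : ℕ} (S : Set (Fin n → HahnField)) :
    Submodule.span HahnField (PointedCone.hull HahnField S : Set (Fin n → HahnField)) =
      Submodule.span HahnField S :=
  le_antisymm (Submodule.span_le.2 fun _ hx => PointedCone.hull_le_span HahnField S hx)
    (Submodule.span_mono PointedCone.subset_hull)

theorem linearIndependent_cons {m : ℕ} {x : Fin (m + 1) → HahnField}
    {u : Fin m → Fin (m + 1) → HahnField} (h : ∑ i, normal u i * x i ≠ 0) :
    LinearIndependent HahnField (Fin.cons x u : Fin (m + 1) → Fin (m + 1) → HahnField) := by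
  rw [sum_normal_mul] at h
  exact Matrix.linearIndependent_cols_of_det_ne_zero h

/-- The points in the hyperplane through `u 1, …, u m` are the linear combinations of these
points. -/
theorem exists_eq_sum_of_sum_normal_eq_zero {m : ℕ} {u : Fin m → Fin (m + 1) → HahnField}
    {x y : Fin (m + 1) → HahnField} (h : ∑ i, normal u i * x i ≠ 0)
    (hy : ∑ i, normal u i * y i = 0) : ∃ b : Fin m → HahnField, y = ∑ k, b k • u k := by
  have hspan := (linearIndependent_cons h).span_eq_top_of_card_eq_finrank' (by simp)
  have hmem : y ∈ Submodule.span HahnField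
      (Set.range (Fin.cons x u : Fin (m + 1) → Fin (m + 1) → HahnField)) := by
    rw [hspan]
    exact Submodule.mem_top
  obtain ⟨b, hb⟩ := (Submodule.mem_span_range_iff_exists_fun HahnField).1 hmem
  rw [Fin.sum_univ_succ] at hb
  simp only [Fin.cons_zero, Fin.cons_succ] at hb
  have hzero : ∀ k, ∑ i, normal u i * u k i = 0 := sum_normal_mul_self u
  have hy' : ∑ i, normal u i * y i = b 0 * ∑ i, normal u i * x i := by
    have hsplit : ∀ i, normal u i * y i =
        b 0 * (normal u i * x i) + ∑ k : Fin m, b k.succ * (normal u i * u k i) := fun i => by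
      rw [← hb]
      simp only [Pi.add_apply, Pi.smul_apply, smul_eq_mul, Finset.sum_apply, mul_add,
        Finset.mul_sum]
      congr 1
      · ring
      · exact Finset.sum_congr rfl fun k _ => by ring
    simp_rw [hsplit, Finset.sum_add_distrib]
    rw [Finset.sum_comm, ← Finset.mul_sum]
    simp_rw [← Finset.mul_sum, hzero, mul_zero, Finset.sum_const_zero, add_zero]
  have hb0 : b 0 = 0 := by
    rw [hy] at hy'
    exact (mul_eq_zero.1 hy'.symm).resolve_right h
  rw [hb0, zero_smul, zero_add] at hb
  exact ⟨fun k => b k.succ, hb.symm⟩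

/-- A face spanned by `u 1, …, u m` does not strictly separate two points of the cone. -/
theorem not_separated_of_isFaceOf {m : ℕ} {u : Fin m → Fin (m + 1) → HahnField}
    {C : PointedCone HahnField (Fin (m + 1) → HahnField)}
    (hF : (PointedCone.hull HahnField (Set.range u)).IsFaceOf C) {x y : Fin (m + 1) → HahnField}
    (hx : x ∈ C) (hy : y ∈ C) (hxpos : 0 < ∑ i, normal u i * x i) :
    0 ≤ ∑ i, normal u i * y i := by
  by_contra! hyneg
  set α := ∑ i, normal u i * x i
  set β := ∑ i, normal u i * y i
  obtain ⟨b, hb⟩ := exists_eq_sum_of_sum_normal_eq_zero hxpos.ne'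
    (y := (-β) • x + α • y) (by
      simp only [Pi.add_apply, Pi.smul_apply, smul_eq_mul, mul_add, Finset.sum_add_distrib,
        mul_left_comm (normal u _), ← Finset.mul_sum]
      simp only [α, β]
      ring)
  have hsum : ∀ c : Fin m → HahnField, (∀ k, 0 ≤ c k) →
      ∑ k, c k • u k ∈ PointedCone.hull HahnField (Set.range u) := fun c hc =>
    Submodule.sum_mem _ fun k _ => PointedCone.smul_mem _ (hc k)
      (PointedCone.subset_hull ⟨k, rfl⟩)
  -- The combination of `x` and `y` on the hyperplane may have negative coefficients `b k`. Adding
  -- `|b k| • u k` moves it into the face without leaving the cone, so the face property forces `x`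
  -- into the face.
  have hmem : (-β) • x + (α • y + ∑ k, |b k| • u k) ∈
      PointedCone.hull HahnField (Set.range u) := by
    rw [← add_assoc, hb, ← Finset.sum_add_distrib]
    simp_rw [← add_smul]
    exact hsum _ fun k => by linarith [neg_abs_le (b k)]
  have hxF := hF.mem_of_smul_add_mem hx
    (add_mem (PointedCone.smul_mem _ hxpos.le hy) (hF.le (hsum _ fun k => abs_nonneg (b k))))
    (neg_pos.2 hyneg) hmem
  refine hxpos.ne' (sum_eq_zero_of_mem_hull ?_ hxF)
  rintro _ ⟨k, rfl⟩
  exact sum_normal_mul_self u k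

/-- A half-space which contains all generators of a cone and has `m` linearly independent ones on
its boundary, and some other one in its interior, defines a facet. -/
theorem isFacet_hull {m p : ℕ} {w : Fin p → Fin (m + 1) → HahnField} {e : Fin m → Fin p}
    (hn : ∀ s ∉ Set.range e, ∑ i, normal (w ∘ e) i * w s i ≠ 0) (hs : ∃ s, s ∉ Set.range e)
    {f : Fin (m + 1) → HahnField} (h0 : ∀ k, ∑ i, f i * w (e k) i = 0)
    (hpos : ∀ s ∉ Set.range e, 0 < ∑ i, f i * w s i) :
    IsFacet (PointedCone.hull HahnField (Set.range (w ∘ e)))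
        (PointedCone.hull HahnField (Set.range w)) ∧
      IsDefiningHalfSpace {x | 0 ≤ ∑ i, f i * x i}
        (PointedCone.hull HahnField (Set.range (w ∘ e)))
        (PointedCone.hull HahnField (Set.range w)) := by
  have hS : ∀ x ∈ Set.range (w ∘ e), ∑ i, f i * x i = 0 := by
    rintro _ ⟨k, rfl⟩
    exact h0 k
  have hT : ∀ x ∈ Set.range w, x ∉ Set.range (w ∘ e) → 0 < ∑ i, f i * x i := by
    rintro _ ⟨s, rfl⟩ hx
    exact hpos s fun ⟨k, hk⟩ => hx ⟨k, congrArg w hk⟩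
  have hle : PointedCone.hull HahnField (Set.range (w ∘ e)) ≤
      PointedCone.hull HahnField (Set.range w) := Submodule.span_mono (Set.range_comp_subset_range e w)
  obtain ⟨s, hs⟩ := hs
  refine ⟨⟨⟨hle, fun {x y a} hx hy ha hxy => ?_⟩, ?_⟩, f, ?_, rfl, fun x hx =>
    (nonneg_and_mem_hull_of_mem_hull hS hT hx).1, Set.ext fun x => ⟨fun hx =>
      ⟨hle hx, sum_eq_zero_of_mem_hull hS hx⟩, fun hx =>
      (nonneg_and_mem_hull_of_mem_hull hS hT hx.1).2 hx.2⟩⟩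
  · obtain ⟨hx1, hx2⟩ := nonneg_and_mem_hull_of_mem_hull hS hT hx
    obtain ⟨hy1, -⟩ := nonneg_and_mem_hull_of_mem_hull hS hT hy
    have h := sum_eq_zero_of_mem_hull hS hxy
    simp only [Pi.add_apply, Pi.smul_apply, smul_eq_mul, mul_add, Finset.sum_add_distrib,
      mul_left_comm (f _), ← Finset.mul_sum] at h
    have hax : 0 ≤ a * ∑ i, f i * x i := mul_nonneg ha.le hx1
    exact hx2 ((mul_eq_zero.1 (by linarith : a * ∑ i, f i * x i = 0)).resolve_left ha.ne')
  · have hli := linearIndependent_cons (hn s hs)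
    have hli' : LinearIndependent HahnField (w ∘ e) := by
      have := hli.comp Fin.succ (Fin.succ_injective m)
      simpa [Function.comp_def] using this
    have htop : Submodule.span HahnField (Set.range w) = ⊤ := by
      rw [eq_top_iff, ← hli.span_eq_top_of_card_eq_finrank' (by simp)]
      refine Submodule.span_mono ?_
      rintro _ ⟨k, rfl⟩
      refine Fin.cases ⟨s, rfl⟩ (fun k => ⟨e k, rfl⟩) k
    rw [span_hull, span_hull, finrank_span_eq_card hli', htop, finrank_top]
    simp
  · rintro rfl
    simpa using hpos s hs

/-- Forms vanishing on the facet generators make up a line, and the generator `w s` off the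
hyperplane fixes the sign of the factor. -/
theorem IsDefiningHalfSpace.eq {m p : ℕ} {w : Fin p → Fin (m + 1) → HahnField}
    {e : Fin m → Fin p} (hn : normal (w ∘ e) 0 ≠ 0) {f : Fin (m + 1) → HahnField}
    (hf : f ≠ 0) (h0 : ∀ k, ∑ i, f i * w (e k) i = 0) {s : Fin p} (hs : 0 < ∑ i, f i * w s i)
    {H : Set (Fin (m + 1) → HahnField)}
    (hH : IsDefiningHalfSpace H (PointedCone.hull HahnField (Set.range (w ∘ e)))
      (PointedCone.hull HahnField (Set.range w))) :
    H = {x | 0 ≤ ∑ i, f i * x i} := by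
  obtain ⟨g, hg0, rfl, hC, hF⟩ := hH
  have hg : ∀ k, ∑ i, g i * w (e k) i = 0 := fun k => by
    have : w (e k) ∈ (PointedCone.hull HahnField (Set.range (w ∘ e)) :
        Set (Fin (m + 1) → HahnField)) := PointedCone.subset_hull ⟨k, rfl⟩
    rw [hF] at this
    exact this.2
  obtain ⟨κ, hκ⟩ := eq_mul_normal hn hg
  obtain ⟨μ, hμ⟩ := eq_mul_normal hn h0
  have hμ0 : μ ≠ 0 := by
    rintro rfl
    exact hf (funext fun i => by rw [hμ, zero_mul, Pi.zero_apply])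
  have hgf : ∀ x : Fin (m + 1) → HahnField, ∑ i, g i * x i = κ / μ * ∑ i, f i * x i := by
    intro x
    rw [Finset.mul_sum]
    refine Finset.sum_congr rfl fun i _ => ?_
    rw [hκ, hμ]
    field_simp
  have hκ0 : κ / μ ≠ 0 := by
    refine div_ne_zero ?_ hμ0
    rintro rfl
    exact hg0 (funext fun i => by rw [hκ, zero_mul, Pi.zero_apply])
  have hnn : 0 ≤ κ / μ * ∑ i, f i * w s i := by
    rw [← hgf]
    exact hC (PointedCone.subset_hull ⟨s, rfl⟩)
  have hκpos : 0 < κ / μ := lt_of_le_of_ne (nonneg_of_mul_nonneg_left hnn hs) hκ0.symm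
  ext x
  rw [Set.mem_ofPred_eq, Set.mem_ofPred_eq, hgf, mul_nonneg_iff_of_pos_left hκpos]

end TropicalLift

/-! ### Facets of the lifted cone and supporting tropical half-spaces -/

theorem mainTheorem3 (n p : ℕ) (hn : 2 ≤ n) (hp : n ≤ p)
    (v : Fin p → Fin n → ℝ) (hv : GeneralPosition v)
    (w : Fin p → Fin n → HahnField) (hw : IsLift w v)
    (R : Finset (Fin p)) (hR : R.card + 1 = n) :
    (IsFacet (PointedCone.hull HahnField (w '' (R : Set (Fin p))))
        (PointedCone.hull HahnField (Set.range w)) ↔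
      ∃ (a : Fin n → ℝ) (I : Finset (Fin n)), I.Nonempty ∧ Iᶜ.Nonempty ∧
        tropicalPolytope v ⊆ tropicalHalfSpace a I ∧
        ∀ r ∈ R, toTP (v r) ∈ frontier (tropicalHalfSpace a I)) ∧
    ∀ (a : Fin n → ℝ) (I : Finset (Fin n)), I.Nonempty → Iᶜ.Nonempty →
      tropicalPolytope v ⊆ tropicalHalfSpace a I →
      (∀ r ∈ R, toTP (v r) ∈ frontier (tropicalHalfSpace a I)) →
      (∃! H : Set (Fin n → HahnField),
        IsDefiningHalfSpace H (PointedCone.hull HahnField (w '' (R : Set (Fin p))))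
          (PointedCone.hull HahnField (Set.range w))) ∧
      ∀ H : Set (Fin n → HahnField),
        IsDefiningHalfSpace H (PointedCone.hull HahnField (w '' (R : Set (Fin p))))
          (PointedCone.hull HahnField (Set.range w)) →
        valImage H = tropicalHalfSpace a I := by
  obtain ⟨m, rfl⟩ : ∃ m, n = m + 1 := ⟨n - 1, by lia⟩
  have hRm : R.card = m := by lia
  obtain ⟨e, he, heR⟩ : ∃ e : Fin m → Fin p, Function.Injective e ∧
      Set.range e = (R : Set (Fin p)) :=
    ⟨R.orderEmbOfFin hRm, (R.orderEmbOfFin hRm).injective, R.range_orderEmbOfFin hRm⟩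
  have hs : ∃ s, s ∉ Set.range e := by
    by_contra! hall
    have := Fintype.card_le_of_surjective e hall
    simp only [Fintype.card_fin] at this
    lia
  have himage : w '' (R : Set (Fin p)) = Set.range (w ∘ e) := by rw [Set.range_comp, heR]
  obtain ⟨hw0, hwv⟩ := hw
  choose c hc using fun r => toTP_eq_toTP_iff.1 (hwv r)
  have hhalf : ∀ (a : Fin (m + 1) → ℝ) (I : Finset (Fin (m + 1))) (r : Fin p),
      InHalfSpace a I (v r) ↔ InHalfSpace a I fun i => val (w r i) := fun a I r =>
    ⟨fun h => h.of_add_const (c := -c r) fun i => by rw [hc]; ring, fun h => h.of_add_const (hc r)⟩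
  have hsupp : ∀ (a : Fin (m + 1) → ℝ) (I : Finset (Fin (m + 1))), I.Nonempty →
      ((tropicalPolytope v ⊆ tropicalHalfSpace a I ∧
        ∀ r ∈ R, toTP (v r) ∈ frontier (tropicalHalfSpace a I)) ↔
      (∀ r, InHalfSpace a I fun i => val (w r i)) ∧
        ∀ k, InHalfSpace a Iᶜ fun i => val (w (e k) i)) := by
    intro a I hI
    rw [tropicalPolytope_subset_tropicalHalfSpace_iff]
    simp_rw [toTP_mem_frontier_tropicalHalfSpace hI, hhalf]
    refine and_congr_right fun h => ⟨fun h' k => (h' (e k) ?_).2, fun h' r hr => ⟨h r, ?_⟩⟩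
    · exact Finset.mem_coe.1 (heR ▸ Set.mem_range_self k)
    · obtain ⟨k, rfl⟩ : r ∈ Set.range e := heR ▸ hr
      exact h' k
  obtain ⟨hn1, hn2⟩ := hv.normal_of_lift (V := fun r i => val (w r i)) hc he hw0 hw0
    (fun _ _ => rfl) (fun _ _ => rfl)
  have hlift := fun (a : Fin (m + 1) → ℝ) (I : Finset (Fin (m + 1))) (hI : I.Nonempty) =>
    hv.exists_lift_halfSpace (V := fun r i => val (w r i)) hc he hw0 (fun _ _ => rfl)
      (a := a) (I := I) hI
  rw [himage]
  refine ⟨⟨fun hfacet => ?_, ?_⟩, ?_⟩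
  · have hside : ∃ f : Fin (m + 1) → HahnField, (∀ i, f i ≠ 0) ∧
        (∀ k, ∑ i, f i * w (e k) i = 0) ∧ ∀ r, 0 ≤ ∑ i, f i * w r i := by
      have hmem : ∀ r, w r ∈ PointedCone.hull HahnField (Set.range w) := fun r =>
        PointedCone.subset_hull ⟨r, rfl⟩
      -- The normal is determined up to sign only. A face does not separate generators, so one of
      -- the two signs is non-negative on all of them.
      by_cases hex : ∃ r, 0 < ∑ i, normal (w ∘ e) i * w r i
      · obtain ⟨r, hr⟩ := hex
        exact ⟨normal (w ∘ e), fun i => (hn1 i).1, sum_normal_mul_self (w ∘ e), fun s =>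
          not_separated_of_isFaceOf hfacet.1 (hmem r) (hmem s) hr⟩
      · push Not at hex
        refine ⟨fun i => -normal (w ∘ e) i, fun i => neg_ne_zero.2 (hn1 i).1, fun k => ?_,
          fun r => ?_⟩ <;> simp only [neg_mul, Finset.sum_neg_distrib]
        · exact neg_eq_zero.2 (sum_normal_mul_self (w ∘ e) k)
        · exact neg_nonneg.2 (hex r)
    obtain ⟨f, hf, hf0, hfr⟩ := hside
    classical
    let a : Fin (m + 1) → ℝ := fun i => -val (f i)
    let I : Finset (Fin (m + 1)) := Finset.univ.filter fun i => 0 < f i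
    have hI : ∀ i, 0 < f i ↔ i ∈ I := fun i => by simp [I]
    have hI' : ∀ i, 0 < -f i ↔ i ∈ Iᶜ := fun i => by
      rw [Finset.mem_compl, ← hI, not_lt, neg_pos, (hf i).le_iff_lt]
    have h1 : ∀ r, InHalfSpace a I fun i => val (w r i) := fun r =>
      inHalfSpace_val_of_sum_nonneg hf (hw0 r) (hfr r) hI fun i => (neg_neg _).symm
    have h2 : ∀ k, InHalfSpace a Iᶜ fun i => val (w (e k) i) := fun k =>
      inHalfSpace_val_of_sum_nonneg (f := fun i => -f i) (fun i => neg_ne_zero.2 (hf i))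
        (hw0 (e k)) (by simp [hf0]) hI' fun i => (val_neg _).trans (neg_neg _).symm
    -- Since `n ≥ 2` there is a generator on the hyperplane. It satisfies the inequalities for both
    -- `I` and `Iᶜ`, so neither set is empty.
    have k : Fin m := ⟨0, by lia⟩
    have hIne : I.Nonempty := by
      by_contra hemp
      obtain ⟨i, hi, -⟩ := h1 (e k) 0 (by simp [Finset.not_nonempty_iff_eq_empty.1 hemp])
      exact hemp ⟨i, hi⟩
    have hIne' : Iᶜ.Nonempty := by
      by_contra hemp
      obtain ⟨i, hi, -⟩ := h2 k 0 (by simp [Finset.not_nonempty_iff_eq_empty.1 hemp])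
      exact hemp ⟨i, hi⟩
    exact ⟨a, I, hIne, hIne', (hsupp a I hIne).2 ⟨h1, h2⟩⟩
  · rintro ⟨a, I, hI, hI', hP⟩
    obtain ⟨h1, h2⟩ := (hsupp a I hI).1 hP
    obtain ⟨f, -, -, -, hf0, hfpos⟩ := hlift a I hI hI' h1 h2
    exact (isFacet_hull (fun s hs => (hn2 s hs).1) hs hf0 hfpos).1
  · intro a I hI hI' hP hR'
    obtain ⟨h1, h2⟩ := (hsupp a I hI).1 ⟨hP, hR'⟩
    obtain ⟨f, hf, hfI, hfa, hf0, hfpos⟩ := hlift a I hI hI' h1 h2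
    have hdef := (isFacet_hull (fun s hs => (hn2 s hs).1) hs hf0 hfpos).2
    obtain ⟨s, hs⟩ := hs
    have huniq := fun (H : Set (Fin (m + 1) → HahnField)) hH =>
      IsDefiningHalfSpace.eq (hn1 0).1 (fun h => hf 0 (congrFun h 0)) hf0 (hfpos s hs) (H := H) hH
    refine ⟨⟨_, hdef, huniq⟩, fun H hH => ?_⟩
    rw [huniq H hH]
    exact valImage_setOf_sum_nonneg hf hI hfI hfa
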